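/- Theorem 1.4. All $C^*$-algebras and $*$-homomorphisms below are unital. Let $n$ be a positive integer. A $C^*$-algebra $X$ belongs to $\mathcal{AP}(n)$ if for every $a\in X$ with $\|a\|\le 1$ and every $\varepsilon>0$ there is $b\in X$ with $\|b\|\le 1$ and $\|a-b^n\|<\varepsilon$. It belongs to $\mathcal{HP}(n)$ if this holds for every invertible $a\in X$ with $\|a\|\le 1$. It belongs to $\mathcal{AP}_1(n)$ if it belongs to $\mathcal{AP}(n)$ and has bounded rank at most $1$ in the sense of Chigogidze and Valov: for every pair $(x_1,x_2)$ of self-adjoint elements of $X$ and every $\varepsilon>0$ there is a pair $(y_1,y_2)$ of self-adjoint elements with $\|x_k-y_k\|<\varepsilon$ $(k=1,2)$ that is unessential, i.e. for every rational $\delta>0$ there are self-adjoint $z_1,z_2\in X$ such that $\|y_k-z_k\|\le\delta$ $(k=1,2)$, the element $z_1^2+z_2^2$ is invertible, and $\|(z_1^2+z_2^2)^{-1}\|\le 1/\delta^2$. Let $C^*(\mathbb F_\infty)$ be the (full) group $C^*$-algebra of the free group $\mathbb F_\infty$ on countably infinitely many generators, i.e. the completion of the complex group ring, with involution determined by $g^*=g^{-1}$,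 in its largest $C^*$-seminorm. For a class $\mathcal K$ of $C^*$-algebras, a $*$-homomorphism $p\colon A\to B$ is called $\mathcal K$-invertible if for every $X\in\mathcal K$ and every $*$-homomorphism $g\colon A\to X$ there is a $*$-homomorphism $h\colon B\to X$ with $g=h\circ p$. Let $\mathcal K$ be one of the classes $\mathcal{AP}(n)$, $\mathcal{AP}_1(n)$, $\mathcal{HP}(n)$. Then there exist a separable $C^*$-algebra $Z_{\mathcal K}\in\mathcal K$ and a $\mathcal K$-invertible $*$-homomorphism $p\colon C^*(\mathbb F_\infty)\to Z_{\mathcal K}$. Consequently, $Z_{\mathcal K}$ is a universal element of the class of separable members of $\mathcal K$: for every separable $X\in\mathcal K$ there is a surjective $*$-homomorphism $Z_{\mathcal K}\to X$. -/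

import Mathlib

universe w

/-! ### The full group C⋆-algebra -/

/-- A C⋆-seminorm on a unital complex ⋆-algebra. -/
structure CStarSeminorm (A : Type*) [Ring A] [StarRing A] [Algebra ℂ A]
    extends Seminorm ℂ A where
  mul_le' : ∀ a b : A, toFun (a * b) ≤ toFun a * toFun b
  star_mul_self' : ∀ a : A, toFun (star a * a) = toFun a ^ 2

namespace CStarSeminorm

variable {A : Type*} [Ring A] [StarRing A] [Algebra ℂ A]

/-- The zero C⋆-seminorm. -/
noncomputable instance : Inhabited (CStarSeminorm A) :=
  ⟨{ (0 : Seminorm ℂ A) with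
      mul_le' := fun a b => by
        change (0 : ℝ) ≤ 0 * 0
        simp
      star_mul_self' := fun a => by
        change (0 : ℝ) = 0 ^ 2
        simp }⟩

theorem star_le (p : CStarSeminorm A) (a : A) :
    p.toSeminorm a ≤ p.toSeminorm (star a) := by
  have h1 : p.toSeminorm (star a * a) = p.toSeminorm a ^ 2 := p.star_mul_self' a
  have h2 : p.toSeminorm (star a * a) ≤ p.toSeminorm (star a) * p.toSeminorm a :=
    p.mul_le' _ _
  have h3 := apply_nonneg p.toSeminorm a
  have h4 := apply_nonneg p.toSeminorm (star a)
  nlinarith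

theorem star_eq (p : CStarSeminorm A) (a : A) :
    p.toSeminorm (star a) = p.toSeminorm a :=
  le_antisymm (by simpa using p.star_le (star a)) (p.star_le a)

end CStarSeminorm

/-- The complex group ring `ℂ[G]`, to be equipped with the involution
`(∑ c_g g)⋆ = ∑ conj(c_g) g⁻¹` and with its largest C⋆-seminorm. -/
def StarGroupRing (G : Type*) : Type _ := MonoidAlgebra ℂ G

namespace StarGroupRing

variable (G : Type*) [Group G]

noncomputable instance : Ring (StarGroupRing G) := inferInstanceAs (Ring (MonoidAlgebra ℂ G))

noncomputable instance : Algebra ℂ (StarGroupRing G) :=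
  inferInstanceAs (Algebra ℂ (MonoidAlgebra ℂ G))

variable {G}

/-- The group element `g`, as an element of the group ring. -/
noncomputable def of : G →* StarGroupRing G := MonoidAlgebra.of ℂ G

theorem induction {P : StarGroupRing G → Prop} (a : StarGroupRing G)
    (hof : ∀ g, P (of g)) (hadd : ∀ x y, P x → P y → P (x + y))
    (hsmul : ∀ (c : ℂ) x, P x → P (c • x)) : P a :=
  MonoidAlgebra.induction_on (motive := P) a hof hadd hsmul

/-- The involution as a ring homomorphism into the opposite ring: the conjugate-linear
extension of `g ↦ g⁻¹`. -/
noncomputable def starHom : StarGroupRing G →+* (StarGroupRing G)ᵐᵒᵖ :=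
  MonoidAlgebra.liftNCRingHom (k := ℂ) (G := G)
    ((algebraMap ℂ (StarGroupRing G)ᵐᵒᵖ).comp (starRingEnd ℂ))
    { toFun := fun g => MulOpposite.op (of g⁻¹)
      map_one' := by simp
      map_mul' := fun g h => by simp }
    (fun c _ => Algebra.commutes (R := ℂ) (A := (StarGroupRing G)ᵐᵒᵖ) (starRingEnd ℂ c) _)

theorem starHom_of (g : G) : starHom (of g) = MulOpposite.op (of g⁻¹) := by
  have := MonoidAlgebra.liftNC_single (k := ℂ) (G := G)
    ((algebraMap ℂ (StarGroupRing G)ᵐᵒᵖ).comp (starRingEnd ℂ) : ℂ →+ (StarGroupRing G)ᵐᵒᵖ)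
    (fun g => MulOpposite.op (of g⁻¹)) g 1
  refine Eq.trans this ?_
  simp

theorem starHom_smul (c : ℂ) (a : StarGroupRing G) :
    starHom (c • a) = (starRingEnd ℂ c) • starHom a := by
  have h : starHom (algebraMap ℂ (StarGroupRing G) c)
      = algebraMap ℂ (StarGroupRing G)ᵐᵒᵖ (starRingEnd ℂ c) := by
    have := MonoidAlgebra.liftNC_single (k := ℂ) (G := G)
      ((algebraMap ℂ (StarGroupRing G)ᵐᵒᵖ).comp (starRingEnd ℂ) : ℂ →+ (StarGroupRing G)ᵐᵒᵖ)
      (fun g => MulOpposite.op (of g⁻¹)) 1 c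
    refine Eq.trans this ?_
    simp
  rw [Algebra.smul_def, map_mul, h, ← Algebra.smul_def]

noncomputable instance : StarRing (StarGroupRing G) where
  star a := (starHom a).unop
  star_involutive a := by
    change (starHom (starHom a).unop).unop = a
    induction a using induction with
    | hof g => simp [starHom_of]
    | hadd x y hx hy => simp [hx, hy]
    | hsmul c x hx => simp [starHom_smul, hx]
  star_mul a b := by
    change (starHom (a * b)).unop = (starHom b).unop * (starHom a).unop
    simp
  star_add a b := by
    change (starHom (a + b)).unop = (starHom a).unop + (starHom b).unop
    simp

theorem star_of (g : G) : star (of g) = of g⁻¹ := by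
  change (starHom (of g)).unop = _
  simp [starHom_of]

instance : StarModule ℂ (StarGroupRing G) where
  star_smul c a := by
    change (starHom (c • a)).unop = star c • (starHom a).unop
    simp [starHom_smul]

theorem seminorm_of_le_one (p : CStarSeminorm (StarGroupRing G)) (g : G) :
    p.toSeminorm (of g) ≤ 1 := by
  have h (x : StarGroupRing G) : p.toSeminorm (star x * x) = p.toSeminorm x ^ 2 :=
    p.star_mul_self' x
  have h1 := h 1
  have hg := h (of g)
  rw [star_of, ← map_mul] at hg
  simp only [inv_mul_cancel, map_one, star_one, mul_one] at h1 hg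
  have h0 := apply_nonneg p.toSeminorm (1 : StarGroupRing G)
  have hle : p.toSeminorm (1 : StarGroupRing G) ≤ 1 := by nlinarith
  have := apply_nonneg p.toSeminorm (of g)
  nlinarith

theorem bddAbove_seminorms (a : StarGroupRing G) :
    BddAbove (Set.range fun p : CStarSeminorm (StarGroupRing G) => p.toSeminorm a) := by
  induction a using induction with
  | hof g => exact ⟨1, by rintro _ ⟨p, rfl⟩; exact seminorm_of_le_one p g⟩
  | hadd x y hx hy =>
    obtain ⟨M, hM⟩ := hx
    obtain ⟨N, hN⟩ := hy
    refine ⟨M + N, ?_⟩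
    rintro _ ⟨p, rfl⟩
    exact (map_add_le_add p.toSeminorm x y).trans (add_le_add (hM ⟨p, rfl⟩) (hN ⟨p, rfl⟩))
  | hsmul c x hx =>
    obtain ⟨M, hM⟩ := hx
    refine ⟨‖c‖ * M, ?_⟩
    rintro _ ⟨p, rfl⟩
    change p.toSeminorm (c • x) ≤ _
    rw [map_smul_eq_mul]
    exact mul_le_mul_of_nonneg_left (hM ⟨p, rfl⟩) (norm_nonneg c)

/-- The largest C⋆-seminorm on the group ring, i.e. the supremum of all of them. -/
noncomputable def maxNorm (a : StarGroupRing G) : ℝ :=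
  ⨆ p : CStarSeminorm (StarGroupRing G), p.toSeminorm a

theorem le_maxNorm (p : CStarSeminorm (StarGroupRing G)) (a : StarGroupRing G) :
    p.toSeminorm a ≤ maxNorm a :=
  le_ciSup (bddAbove_seminorms a) p

theorem maxNorm_le {a : StarGroupRing G} {r : ℝ}
    (h : ∀ p : CStarSeminorm (StarGroupRing G), p.toSeminorm a ≤ r) : maxNorm a ≤ r :=
  ciSup_le h

theorem maxNorm_nonneg (a : StarGroupRing G) : 0 ≤ maxNorm a :=
  (apply_nonneg _ _).trans (le_maxNorm default a)

theorem maxNorm_star (a : StarGroupRing G) : maxNorm (star a) = maxNorm a := by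
  simp only [maxNorm, CStarSeminorm.star_eq]

theorem maxNorm_mul_le (a b : StarGroupRing G) : maxNorm (a * b) ≤ maxNorm a * maxNorm b :=
  maxNorm_le fun p => (p.mul_le' a b).trans <|
    mul_le_mul (le_maxNorm p a) (le_maxNorm p b) (apply_nonneg p.toSeminorm b) (maxNorm_nonneg a)

theorem sq_maxNorm_le (a : StarGroupRing G) : maxNorm a * maxNorm a ≤ maxNorm (star a * a) := by
  have h : maxNorm a ≤ Real.sqrt (maxNorm (star a * a)) := by
    refine maxNorm_le fun p => Real.le_sqrt_of_sq_le ?_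
    rw [← show p.toSeminorm (star a * a) = p.toSeminorm a ^ 2 from p.star_mul_self' a]
    exact le_maxNorm p _
  calc maxNorm a * maxNorm a
      ≤ Real.sqrt (maxNorm (star a * a)) * Real.sqrt (maxNorm (star a * a)) :=
        mul_self_le_mul_self (maxNorm_nonneg a) h
    _ = maxNorm (star a * a) := Real.mul_self_sqrt (maxNorm_nonneg _)

theorem maxNorm_smul_le (c : ℂ) (a : StarGroupRing G) : maxNorm (c • a) ≤ ‖c‖ * maxNorm a :=
  maxNorm_le fun p => by
    rw [map_smul_eq_mul]
    exact mul_le_mul_of_nonneg_left (le_maxNorm p a) (norm_nonneg c)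

noncomputable instance : SeminormedAddCommGroup (StarGroupRing G) :=
  AddGroupSeminorm.toSeminormedAddCommGroup
    { toFun := maxNorm
      map_zero' := by simp [maxNorm]
      add_le' := fun a b => maxNorm_le fun p =>
        (map_add_le_add p.toSeminorm a b).trans (add_le_add (le_maxNorm p a) (le_maxNorm p b))
      neg' := fun a => by simp [maxNorm] }

theorem norm_def (a : StarGroupRing G) : ‖a‖ = maxNorm a := rfl

noncomputable instance : SeminormedRing (StarGroupRing G) where
  __ := (inferInstance : Ring (StarGroupRing G))
  __ := (inferInstance : SeminormedAddCommGroup (StarGroupRing G))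
  norm_mul_le := maxNorm_mul_le

noncomputable instance : NormedAlgebra ℂ (StarGroupRing G) where
  norm_smul_le := maxNorm_smul_le

noncomputable instance : NormedStarGroup (StarGroupRing G) where
  norm_star_le a := (maxNorm_star a).le

end StarGroupRing

/-- The (full) group C⋆-algebra `C⋆(G)` of a discrete group `G`: the (Hausdorff) completion
of the group ring with respect to its largest C⋆-seminorm. -/
noncomputable def GroupCStarAlgebra (G : Type*) [Group G] : Type _ :=
  UniformSpace.Completion (StarGroupRing G)

namespace GroupCStarAlgebra

open UniformSpace

variable (G : Type*) [Group G]

noncomputable instance : NormedRing (GroupCStarAlgebra G) :=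
  inferInstanceAs (NormedRing (Completion (StarGroupRing G)))

instance : CompleteSpace (GroupCStarAlgebra G) :=
  inferInstanceAs (CompleteSpace (Completion (StarGroupRing G)))

noncomputable instance : Algebra ℂ (GroupCStarAlgebra G) :=
  inferInstanceAs (Algebra ℂ (Completion (StarGroupRing G)))

noncomputable instance : NormedAlgebra ℂ (GroupCStarAlgebra G) where
  norm_smul_le := norm_smul_le (α := ℂ) (β := Completion (StarGroupRing G))

noncomputable instance : Star (GroupCStarAlgebra G) :=
  ⟨Completion.map (star : StarGroupRing G → StarGroupRing G)⟩

variable {G}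

/-- The canonical map of the group ring into the group C⋆-algebra. -/
noncomputable def coe (a : StarGroupRing G) : GroupCStarAlgebra G := (a : Completion (StarGroupRing G))

theorem coe_mul (a b : StarGroupRing G) : coe (a * b) = coe a * coe b := Completion.coe_mul a b

theorem coe_add (a b : StarGroupRing G) : coe (a + b) = coe a + coe b := Completion.coe_add a b

theorem coe_smul (c : ℂ) (a : StarGroupRing G) : coe (c • a) = c • coe a := Completion.coe_smul c a

theorem norm_coe (a : StarGroupRing G) : ‖coe a‖ = ‖a‖ := Completion.norm_coe a

theorem star_coe (a : StarGroupRing G) : star (coe a) = coe (star a) :=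
  Completion.map_coe (star_isometry (E := StarGroupRing G)).uniformContinuous a

theorem continuous_star' : Continuous (star : GroupCStarAlgebra G → GroupCStarAlgebra G) :=
  Completion.continuous_map

theorem denseRange_coe : DenseRange (coe : StarGroupRing G → GroupCStarAlgebra G) :=
  Completion.denseRange_coe

noncomputable instance : StarRing (GroupCStarAlgebra G) where
  star_involutive x := by
    refine denseRange_coe.induction_on x
      (isClosed_eq (continuous_star'.comp continuous_star') continuous_id) fun a => ?_
    simp [star_coe]
  star_mul x y := by
    refine denseRange_coe.induction_on₂
      (isClosed_eq (continuous_star'.comp continuous_mul)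
        ((continuous_star'.comp continuous_snd).mul (continuous_star'.comp continuous_fst)))
      (fun a b => ?_) x y
    simp [star_coe, ← coe_mul]
  star_add x y := by
    refine denseRange_coe.induction_on₂
      (isClosed_eq (continuous_star'.comp continuous_add)
        ((continuous_star'.comp continuous_fst).add (continuous_star'.comp continuous_snd)))
      (fun a b => ?_) x y
    simp [star_coe, ← coe_add]

instance : CStarRing (GroupCStarAlgebra G) where
  norm_mul_self_le x := by
    refine denseRange_coe.induction_on x
      (isClosed_le (continuous_norm.mul continuous_norm)
        (continuous_norm.comp (continuous_star'.mul continuous_id))) fun a => ?_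
    change ‖coe a‖ * ‖coe a‖ ≤ ‖star (coe a) * coe a‖
    rw [star_coe, ← coe_mul, norm_coe, norm_coe]
    exact StarGroupRing.sq_maxNorm_le a

instance : StarModule ℂ (GroupCStarAlgebra G) where
  star_smul c x := by
    refine denseRange_coe.induction_on x
      (isClosed_eq (continuous_star'.comp (continuous_const_smul c))
        (continuous_star'.const_smul (star c))) fun a => ?_
    simp [star_coe, ← coe_smul]

noncomputable instance : CStarAlgebra (GroupCStarAlgebra G) where

end GroupCStarAlgebra

/-! ### Approximate roots and bounded rank -/

/-- The approximate `n`-th root property. -/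
def HasApproxRoots (n : ℕ) (X : Type*) [CStarAlgebra X] : Prop :=
  ∀ a : X, ‖a‖ ≤ 1 → ∀ ε : ℝ, 0 < ε → ∃ b : X, ‖b‖ ≤ 1 ∧ ‖a - b ^ n‖ < ε

/-- The approximate `n`-th root property for invertible elements. -/
def HasApproxRootsOfUnits (n : ℕ) (X : Type*) [CStarAlgebra X] : Prop :=
  ∀ a : X, IsUnit a → ‖a‖ ≤ 1 → ∀ ε : ℝ, 0 < ε → ∃ b : X, ‖b‖ ≤ 1 ∧ ‖a - b ^ n‖ < ε

/-- A tuple `y` is unessential if for every rational `ε > 0` there are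
self-adjoint `z_k` with `‖y_k - z_k‖ ≤ ε` such that `∑ z_k ^ 2` is invertible and
`‖(∑ z_k ^ 2)⁻¹‖ ≤ 1 / ε ^ 2`. -/
def IsUnessential {X : Type*} [CStarAlgebra X] {m : ℕ} (y : Fin m → X) : Prop :=
  ∀ ε : ℚ, 0 < ε → ∃ z : Fin m → X,
    (∀ k, IsSelfAdjoint (z k)) ∧ (∀ k, ‖y k - z k‖ ≤ (ε : ℝ)) ∧
      ∃ u : Xˣ, (u : X) = ∑ k, z k ^ 2 ∧ ‖((u⁻¹ : Xˣ) : X)‖ ≤ 1 / (ε : ℝ) ^ 2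

/-- The bounded rank of `X` (in the sense of Chigogidze and Valov, with constant `1`) is at most
`d`: every `(d + 1)`-tuple of self-adjoint elements can be approximated by unessential
`(d + 1)`-tuples of self-adjoint elements. -/
def BoundedRankLE (X : Type*) [CStarAlgebra X] (d : ℕ) : Prop :=
  ∀ x : Fin (d + 1) → X, (∀ k, IsSelfAdjoint (x k)) → ∀ ε : ℝ, 0 < ε →
    ∃ y : Fin (d + 1) → X, (∀ k, IsSelfAdjoint (y k)) ∧ IsUnessential y ∧
      ∀ k, ‖x k - y k‖ < ε

/-- Names of the three kinds of classes of unital C⋆-algebras. -/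
inductive RootClass : Type
  | AP
  | AP₁
  | HP

/-- Membership of a unital C⋆-algebra in `AP(n)`, `AP₁(n)` or `HP(n)`. -/
def RootClass.Mem (K : RootClass) (n : ℕ) (X : Type*) [CStarAlgebra X] : Prop :=
  match K with
  | .AP => HasApproxRoots n X
  | .AP₁ => HasApproxRoots n X ∧ BoundedRankLE X 1
  | .HP => HasApproxRootsOfUnits n X

/-- A unital ⋆-homomorphism `p : A → B` is invertible with respect to the class if every unital
⋆-homomorphism from `A` to a member of the class factors through `p`. -/
def RootClass.IsInvertibleHom.{u, v, t} (K : RootClass) (n : ℕ) {A : Type u} {B : Type v}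
    [CStarAlgebra A] [CStarAlgebra B] (p : A →⋆ₐ[ℂ] B) : Prop :=
  ∀ (X : Type t) [CStarAlgebra X], K.Mem n X →
    ∀ g : A →⋆ₐ[ℂ] X, ∃ h : B →⋆ₐ[ℂ] X, g = h.comp p

/-- `Y` is a universal element of the class of separable members: it is itself a separable member,
and every separable member is a quotient of `Y`. -/
def RootClass.IsUniversalSeparable.{v, t} (K : RootClass) (n : ℕ) (Y : Type v)
    [CStarAlgebra Y] : Prop :=
  TopologicalSpace.SeparableSpace Y ∧ K.Mem n Y ∧
    ∀ (X : Type t) [CStarAlgebra X], TopologicalSpace.SeparableSpace X → K.Mem n X →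
      ∃ q : Y →⋆ₐ[ℂ] X, Function.Surjective q

/-!
The three classes share two closure properties. They are closed under bounded products
(`RootClass.Mem.lp_infty`): the norm bounds in their definitions do not depend on the algebra, so
witnesses can be chosen coordinate by coordinate. They also satisfy a Löwenheim–Skolem principle
(`RootClass.Mem.exists_separable_starSubalgebra`): every countable subset of a member lies in a
separable C⋆-subalgebra that is a member. For the latter, the existential quantifiers in the
definition of the class are turned into countably many (binary) operations, a countable set is
closed under these operations and under those of a ⋆-algebra over a countable dense set of scalars,
and the closure is taken. In the case of bounded rank, spectral permanence puts the inverse of the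
sum of squares into the subalgebra.

Put `A = C⋆(G)` for a countable group `G`. The image of `A` under a ⋆-homomorphism `g` into a member
`X` lies in a separable member inside `X`, by the second property. A separable C⋆-algebra has at
most continuum many elements, so up to isomorphism it lives on a subset of `ℕ → ℝ`, and there is
only a set of such pairs (algebra, `g`). The product of all these algebras is a member, and a
separable member `Z` inside it contains the diagonal image of `A`. Every `g` factors through
`A → Z` via the coordinate projection that belongs to `g` (`RootClass.exists_isInvertibleHom`).

Finally, a separable `X` is a quotient of `C⋆(𝔽_∞)`
(`exists_surjective_groupCStarAlgebra_freeGroup`): send the generators to a dense sequence of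
unitaries, use that the unitaries span `X`, and that ranges of ⋆-homomorphisms are closed. The
latter follows from the functional calculus, which gives preimages of controlled norm. If `X` is in
the class, factoring this surjection through `Z` gives a surjection `Z → X`.
-/

open TopologicalSpace Filter Topology
open scoped CStarAlgebra ENNReal

/-! ### Maps out of the full group C⋆-algebra -/

namespace StarGroupRing

variable {G : Type*} [Group G] {X : Type*} [CStarAlgebra X]

/-- The C⋆-seminorm `a ↦ ‖f a‖` of a representation `f` of the group ring. -/
noncomputable def seminormOfHom (f : StarGroupRing G →⋆ₐ[ℂ] X) :
    CStarSeminorm (StarGroupRing G) where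
  toSeminorm := (normSeminorm ℂ X).comp f.toAlgHom.toLinearMap
  mul_le' a b := by
    change ‖f (a * b)‖ ≤ ‖f a‖ * ‖f b‖
    rw [map_mul]
    exact norm_mul_le _ _
  star_mul_self' a := by
    change ‖f (star a * a)‖ = ‖f a‖ ^ 2
    rw [map_mul, map_star, CStarRing.norm_star_mul_self, sq]

theorem norm_hom_le (f : StarGroupRing G →⋆ₐ[ℂ] X) (a : StarGroupRing G) : ‖f a‖ ≤ ‖a‖ :=
  le_maxNorm (seminormOfHom f) a

/-- The linear extension of a unitary representation of `G` to the group ring. -/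
noncomputable def liftUnitary (φ : G →* unitary X) : StarGroupRing G →⋆ₐ[ℂ] X :=
  let f : StarGroupRing G →ₐ[ℂ] X :=
    (MonoidAlgebra.lift ℂ X G ((unitary X).subtype.comp φ) : MonoidAlgebra ℂ G →ₐ[ℂ] X)
  have hf : ∀ g, f (of g) = φ g := fun g =>
    MonoidAlgebra.lift_of ((unitary X).subtype.comp φ) g
  { f with
    map_star' := fun a => by
      change f (star a) = star (f a)
      induction a using induction with
      | hof g => rw [star_of, hf, hf, map_inv, ← Unitary.star_eq_inv, Unitary.coe_star]
      | hadd x y hx hy => simp [hx, hy]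
      | hsmul c x hx => simp [star_smul, hx] }

theorem liftUnitary_of (φ : G →* unitary X) (g : G) : liftUnitary φ (of g) = φ g :=
  MonoidAlgebra.lift_of ((unitary X).subtype.comp φ) g

end StarGroupRing

namespace GroupCStarAlgebra

open UniformSpace

variable {G : Type*} [Group G] {X : Type*} [CStarAlgebra X]

theorem continuous_hom (f : StarGroupRing G →⋆ₐ[ℂ] X) : Continuous f :=
  AddMonoidHomClass.continuous_of_bound f 1 fun a => by
    simpa using StarGroupRing.norm_hom_le f a

/-- The extension of a representation of the group ring to the full group C⋆-algebra. -/
noncomputable def lift (f : StarGroupRing G →⋆ₐ[ℂ] X) : GroupCStarAlgebra G →⋆ₐ[ℂ] X :=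
  let F : GroupCStarAlgebra G →+* X :=
    (Completion.extensionHom (f : StarGroupRing G →+* X) (continuous_hom f) :
      Completion (StarGroupRing G) →+* X)
  have hF : ∀ a, F (coe a) = f a := fun a =>
    Completion.extensionHom_coe (f : StarGroupRing G →+* X) (continuous_hom f) a
  have hc : Continuous F :=
    (Completion.continuous_extension : Continuous (Completion.extension f))
  { F with
    commutes' := fun c => by
      change F (algebraMap ℂ _ c) = _
      have h : algebraMap ℂ (GroupCStarAlgebra G) c = coe (algebraMap ℂ _ c) := by
        rw [Algebra.algebraMap_eq_smul_one, Algebra.algebraMap_eq_smul_one, coe_smul]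
        rfl
      rw [h, hF, AlgHomClass.commutes]
    map_star' := fun x => by
      change F (star x) = star (F x)
      refine denseRange_coe.induction_on x
        (isClosed_eq (hc.comp continuous_star') (continuous_star.comp hc)) fun a => ?_
      rw [star_coe, hF, hF, map_star] }

theorem lift_coe (f : StarGroupRing G →⋆ₐ[ℂ] X) (a : StarGroupRing G) : lift f (coe a) = f a :=
  Completion.extensionHom_coe (f : StarGroupRing G →+* X) (continuous_hom f) a

/-- `C⋆(G)` is generated by `G`: a closed subspace that contains the image of the group contains
the whole image of `C⋆(G)`. -/
theorem map_mem_of_forall_of_mem {S : Submodule ℂ X} (hS : IsClosed (S : Set X))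
    (f : GroupCStarAlgebra G →⋆ₐ[ℂ] X) (h : ∀ g : G, f (coe (StarGroupRing.of g)) ∈ S)
    (x : GroupCStarAlgebra G) : f x ∈ S := by
  refine denseRange_coe.induction_on x (hS.preimage (map_continuous f)) fun a => ?_
  induction a using StarGroupRing.induction with
  | hof g => exact h g
  | hadd x y hx hy =>
    rw [coe_add, map_add]
    exact S.add_mem hx hy
  | hsmul c x hx =>
    rw [coe_smul, map_smul]
    exact S.smul_mem c hx

end GroupCStarAlgebra

/-! ### Separable C⋆-algebras as quotients of the group C⋆-algebra of the free group -/

section ClosedRange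

variable {A B : Type*} [CStarAlgebra A] [CStarAlgebra B]

/-- Truncating the spectrum of any self-adjoint preimage gives one of no larger norm. -/
theorem exists_isSelfAdjoint_preimage_norm_le (f : A →⋆ₐ[ℂ] B) {a : A} (ha : IsSelfAdjoint a) :
    ∃ a' : A, f a' = f a ∧ ‖a'‖ ≤ ‖f a‖ := by
  set r := ‖f a‖
  have hr : 0 ≤ r := norm_nonneg _
  let c : ℝ → ℝ := fun t => max (-r) (min t r)
  have hc : Continuous c := by fun_prop
  have hfa : IsSelfAdjoint (f a) := ha.map f
  refine ⟨cfc c a, ?_, ?_⟩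
  · rw [StarAlgHomClass.map_cfc (S := ℂ) f c a hc.continuousOn (map_continuous f) ha hfa]
    conv_rhs => rw [← cfc_id ℝ (f a) hfa]
    refine cfc_congr fun t ht => ?_
    have ht' : |t| ≤ r := by
      rcases subsingleton_or_nontrivial B with hB | hB
      · simp [spectrum.of_subsingleton] at ht
      exact spectrum.norm_le_norm_of_mem ht
    obtain ⟨h1, h2⟩ := abs_le.mp ht'
    simp [c, h1, h2]
  · refine norm_cfc_le hr fun t _ => ?_
    rw [Real.norm_eq_abs, abs_le]
    exact ⟨le_max_left _ _, max_le (by linarith) (min_le_right _ _)⟩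

theorem exists_preimage_norm_le_two_mul (f : A →⋆ₐ[ℂ] B) (a : A) :
    ∃ a' : A, f a' = f a ∧ ‖a'‖ ≤ 2 * ‖f a‖ := by
  obtain ⟨x, hx, hxn⟩ := exists_isSelfAdjoint_preimage_norm_le f (realPart a).2
  obtain ⟨y, hy, hyn⟩ := exists_isSelfAdjoint_preimage_norm_le f (imaginaryPart a).2
  have hre : f (realPart a : A) = realPart (f a) := by
    rw [realPart_apply_coe, realPart_apply_coe, ← Complex.coe_smul, ← Complex.coe_smul,
      map_smul, map_add, map_star]
  have him : f (imaginaryPart a : A) = imaginaryPart (f a) := by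
    rw [imaginaryPart_apply_coe, imaginaryPart_apply_coe, map_smul, ← Complex.coe_smul,
      ← Complex.coe_smul, map_smul, map_sub, map_star]
  refine ⟨x + Complex.I • y, ?_, ?_⟩
  · rw [map_add, map_smul, hx, hy, ← map_smul, ← map_add, realPart_add_I_smul_imaginaryPart]
  · have h1 : ‖x‖ ≤ ‖f a‖ := hxn.trans (by rw [hre]; exact realPart.norm_le (f a))
    have h2 : ‖y‖ ≤ ‖f a‖ := hyn.trans (by rw [him]; exact imaginaryPart.norm_le (f a))
    calc ‖x + Complex.I • y‖ ≤ ‖x‖ + ‖Complex.I • y‖ := norm_add_le _ _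
      _ = ‖x‖ + ‖y‖ := by rw [norm_smul, Complex.norm_I, one_mul]
      _ ≤ 2 * ‖f a‖ := by linarith

/-- The range of a ⋆-homomorphism of C⋆-algebras is closed, so a dense range is everything. -/
theorem StarAlgHom.surjective_of_denseRange (f : A →⋆ₐ[ℂ] B) (hf : DenseRange f) :
    Function.Surjective f := by
  let F : NormedAddGroupHom A B :=
    (f : A →+ B).mkNormedAddGroupHom 1 fun a => by
      simpa using NonUnitalStarAlgHom.norm_apply_le f a
  have hF : F.SurjectiveOnWith F.range 2 := by
    rintro _ ⟨a, rfl⟩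
    exact exists_preimage_norm_le_two_mul f a
  intro b
  obtain ⟨a, ha, -⟩ := controlled_closure_of_complete two_pos one_pos hF b (hf b)
  exact ⟨a, ha⟩

end ClosedRange

/-- A separable unital C⋆-algebra is spanned by its unitaries, hence topologically by a sequence
of them, and the free group maps onto such a sequence. -/
theorem exists_surjective_groupCStarAlgebra_freeGroup (X : Type*) [CStarAlgebra X]
    [SeparableSpace X] :
    ∃ g : GroupCStarAlgebra (FreeGroup ℕ) →⋆ₐ[ℂ] X, Function.Surjective g := by
  have : SecondCountableTopology X := UniformSpace.secondCountable_of_separable X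
  let φ : FreeGroup ℕ →* unitary X := FreeGroup.lift (denseSeq (unitary X))
  let f := GroupCStarAlgebra.lift (StarGroupRing.liftUnitary φ)
  refine ⟨f, f.surjective_of_denseRange ?_⟩
  let S : Submodule ℂ X := (LinearMap.range f.toAlgHom.toLinearMap).topologicalClosure
  have hu : (unitary X : Set X) ⊆ S := by
    intro u hu
    have h : (⟨u, hu⟩ : unitary X) ∈ closure (Set.range (denseSeq (unitary X))) :=
      denseRange_denseSeq _ _
    refine map_mem_closure continuous_subtype_val h ?_
    rintro _ ⟨k, rfl⟩
    refine ⟨GroupCStarAlgebra.coe (StarGroupRing.of (FreeGroup.of k)), ?_⟩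
    change f _ = _
    rw [GroupCStarAlgebra.lift_coe, StarGroupRing.liftUnitary_of, FreeGroup.lift_apply_of]
  intro x
  have hx : x ∈ S :=
    Submodule.span_le.2 hu (by rw [CStarAlgebra.span_unitary]; trivial)
  exact hx

/-! ### Bounded products -/

section Product

variable {ι : Type*} {X : ι → Type*} [∀ i, CStarAlgebra (X i)] [∀ i, Nontrivial (X i)]

noncomputable instance lp.inftyCStarAlgebra : CStarAlgebra (lp X ∞) where

/-- A uniformly bounded family, as an element of the bounded product. -/
def lp.ofBounded (f : ∀ i, X i) {C : ℝ} (h : ∀ i, ‖f i‖ ≤ C) : lp X ∞ :=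
  ⟨f, memℓp_infty ⟨C, by rintro _ ⟨i, rfl⟩; exact h i⟩⟩

/-- The coordinate ⋆-homomorphisms of a bounded product. -/
def lp.evalStarAlgHom (i : ι) : lp X ∞ →⋆ₐ[ℂ] X i where
  toFun f := f i
  map_one' := rfl
  map_mul' _ _ := rfl
  map_zero' := rfl
  map_add' _ _ := rfl
  commutes' _ := rfl
  map_star' _ := rfl

/-- A family of ⋆-homomorphisms is uniformly bounded, hence maps into the bounded product. -/
noncomputable def lp.liftStarAlgHom {A : Type*} [CStarAlgebra A] (g : ∀ i, A →⋆ₐ[ℂ] X i) :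
    A →⋆ₐ[ℂ] lp X ∞ where
  toFun a := lp.ofBounded (fun i => g i a) fun i => NonUnitalStarAlgHom.norm_apply_le (g i) a
  map_one' := by ext i; exact map_one (g i)
  map_mul' a b := by ext i; exact map_mul (g i) a b
  map_zero' := by ext i; exact map_zero (g i)
  map_add' a b := by ext i; exact map_add (g i) a b
  commutes' c := by ext i; exact AlgHomClass.commutes (g i) c
  map_star' a := by ext i; exact map_star (g i) a

theorem HasApproxRoots.lp_infty {n : ℕ} (h : ∀ i, HasApproxRoots n (X i)) :
    HasApproxRoots n (lp X ∞) := by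
  intro a ha ε hε
  choose b hb hab using fun i =>
    h i (a i) ((lp.norm_apply_le_norm ENNReal.top_ne_zero a i).trans ha) (ε / 2) (half_pos hε)
  refine ⟨lp.ofBounded b hb, lp.norm_le_of_forall_le zero_le_one hb, ?_⟩
  exact (lp.norm_le_of_forall_le (half_pos hε).le fun i => (hab i).le).trans_lt (half_lt_self hε)

theorem HasApproxRootsOfUnits.lp_infty {n : ℕ} (h : ∀ i, HasApproxRootsOfUnits n (X i)) :
    HasApproxRootsOfUnits n (lp X ∞) := by
  intro a hu ha ε hε
  choose b hb hab using fun i =>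
    h i (a i) (hu.map (lp.evalStarAlgHom i))
      ((lp.norm_apply_le_norm ENNReal.top_ne_zero a i).trans ha) (ε / 2) (half_pos hε)
  refine ⟨lp.ofBounded b hb, lp.norm_le_of_forall_le zero_le_one hb, ?_⟩
  exact (lp.norm_le_of_forall_le (half_pos hε).le fun i => (hab i).le).trans_lt (half_lt_self hε)

/-- The bound `1 / ε ^ 2` in the definition of unessential tuples does not depend on the algebra,
so that coordinatewise inverses form a bounded family. -/
theorem IsUnessential.lp_infty {m : ℕ} {y : Fin m → lp X ∞}
    (h : ∀ i, IsUnessential fun k => y k i) : IsUnessential y := by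
  intro ε hε
  have hε' : (0 : ℝ) < ε := by exact_mod_cast hε
  choose z hz hyz u hu hun using fun i => h i ε hε
  have hb : ∀ k i, ‖z i k‖ ≤ ‖y k‖ + ε := fun k i => by
    have h1 := lp.norm_apply_le_norm ENNReal.top_ne_zero (y k) i
    have h2 := norm_le_norm_add_norm_sub (y k i) (z i k)
    linarith [hyz i k]
  let Z : Fin m → lp X ∞ := fun k => lp.ofBounded (fun i => z i k) (hb k)
  let V : lp X ∞ := lp.ofBounded (fun i => ((u i)⁻¹ : (X i)ˣ)) hun
  have hZ : ∀ i, (∑ k, Z k ^ 2 : lp X ∞) i = u i := fun i => by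
    rw [hu]
    change lp.evalStarAlgHom i (∑ k, Z k ^ 2) = _
    simp only [map_sum, map_pow]
    rfl
  refine ⟨Z, fun k => ?_, fun k => ?_, ⟨∑ k, Z k ^ 2, V, ?_, ?_⟩, rfl, ?_⟩
  · ext i
    exact hz i k
  · exact lp.norm_le_of_forall_le hε'.le fun i => hyz i k
  · ext i
    change (∑ k, Z k ^ 2 : lp X ∞) i * ((u i)⁻¹ : (X i)ˣ) = 1
    rw [hZ, Units.mul_inv]
  · ext i
    change ((u i)⁻¹ : (X i)ˣ) * (∑ k, Z k ^ 2 : lp X ∞) i = 1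
    rw [hZ, Units.inv_mul]
  · exact lp.norm_le_of_forall_le (by positivity) hun

theorem BoundedRankLE.lp_infty {d : ℕ} (h : ∀ i, BoundedRankLE (X i) d) :
    BoundedRankLE (lp X ∞) d := by
  intro x hx ε hε
  choose y hy hun hxy using fun i =>
    h i (fun k => x k i) (fun k => (hx k).map (lp.evalStarAlgHom i)) (ε / 2) (half_pos hε)
  have hb : ∀ k i, ‖y i k‖ ≤ ‖x k‖ + ε / 2 := fun k i => by
    have h1 := lp.norm_apply_le_norm ENNReal.top_ne_zero (x k) i
    have h2 := norm_le_norm_add_norm_sub (x k i) (y i k)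
    linarith [hxy i k]
  refine ⟨fun k => lp.ofBounded (fun i => y i k) (hb k), fun k => ?_, IsUnessential.lp_infty hun,
    fun k => ?_⟩
  · ext i
    exact hy i k
  · exact (lp.norm_le_of_forall_le (half_pos hε).le fun i => (hxy i k).le).trans_lt
      (half_lt_self hε)

theorem RootClass.Mem.lp_infty {K : RootClass} {n : ℕ} (h : ∀ i, K.Mem n (X i)) :
    K.Mem n (lp X ∞) :=
  match K, h with
  | .AP, h => HasApproxRoots.lp_infty h
  | .AP₁, h => ⟨HasApproxRoots.lp_infty fun i => (h i).1, BoundedRankLE.lp_infty fun i => (h i).2⟩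
  | .HP, h => HasApproxRootsOfUnits.lp_infty h

end Product

/-! ### Invariance under isomorphism -/

section Equiv

variable {X Y : Type*} [CStarAlgebra X] [CStarAlgebra Y]

theorem HasApproxRoots.of_starAlgEquiv {n : ℕ} (e : X ≃⋆ₐ[ℂ] Y) (h : HasApproxRoots n X) :
    HasApproxRoots n Y := by
  intro a ha ε hε
  obtain ⟨b, hb, hab⟩ := h (e.symm a) (by rwa [StarAlgEquiv.norm_map e.symm]) ε hε
  refine ⟨e b, by rwa [StarAlgEquiv.norm_map e], ?_⟩
  rwa [← StarAlgEquiv.norm_map e, map_sub, map_pow,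
    StarAlgEquiv.apply_symm_apply] at hab

theorem HasApproxRootsOfUnits.of_starAlgEquiv {n : ℕ} (e : X ≃⋆ₐ[ℂ] Y)
    (h : HasApproxRootsOfUnits n X) : HasApproxRootsOfUnits n Y := by
  intro a hu ha ε hε
  obtain ⟨b, hb, hab⟩ := h (e.symm a) (hu.map e.symm)
    (by rwa [StarAlgEquiv.norm_map e.symm]) ε hε
  refine ⟨e b, by rwa [StarAlgEquiv.norm_map e], ?_⟩
  rwa [← StarAlgEquiv.norm_map e, map_sub, map_pow,
    StarAlgEquiv.apply_symm_apply] at hab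

theorem IsUnessential.map_starAlgEquiv (e : X ≃⋆ₐ[ℂ] Y) {m : ℕ} {y : Fin m → X}
    (h : IsUnessential y) : IsUnessential fun k => e (y k) := by
  intro ε hε
  obtain ⟨z, hz, hyz, u, hu, hun⟩ := h ε hε
  refine ⟨fun k => e (z k), fun k => (hz k).map e, fun k => ?_,
    Units.map (e : X →* Y) u, ?_, ?_⟩
  · rw [← map_sub, StarAlgEquiv.norm_map e]
    exact hyz k
  · change e u = _
    simp [hu]
  · change ‖e ((u⁻¹ : Xˣ) : X)‖ ≤ _
    rwa [StarAlgEquiv.norm_map e]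

theorem BoundedRankLE.of_starAlgEquiv {d : ℕ} (e : X ≃⋆ₐ[ℂ] Y) (h : BoundedRankLE X d) :
    BoundedRankLE Y d := by
  intro x hx ε hε
  obtain ⟨y, hy, hun, hxy⟩ := h (fun k => e.symm (x k)) (fun k => (hx k).map e.symm) ε hε
  refine ⟨fun k => e (y k), fun k => (hy k).map e, hun.map_starAlgEquiv e, fun k => ?_⟩
  have := hxy k
  rwa [← StarAlgEquiv.norm_map e, map_sub,
    StarAlgEquiv.apply_symm_apply] at this

theorem RootClass.Mem.of_starAlgEquiv {K : RootClass} {n : ℕ} (e : X ≃⋆ₐ[ℂ] Y)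
    (h : K.Mem n X) : K.Mem n Y :=
  match K, h with
  | .AP, h => HasApproxRoots.of_starAlgEquiv e h
  | .AP₁, h => ⟨h.1.of_starAlgEquiv e, h.2.of_starAlgEquiv e⟩
  | .HP, h => HasApproxRootsOfUnits.of_starAlgEquiv e h

/-- Transport of a C⋆-algebra structure along a bijection. -/
noncomputable abbrev Equiv.cstarAlgebra {α β : Type*} (e : α ≃ β) [CStarAlgebra β] :
    CStarAlgebra α :=
  letI r : NormedRing α := e.normedRing
  letI s : StarRing α := e.starRing
  letI a : Algebra ℂ α := e.algebra ℂ
  have hiso : Isometry e := Isometry.of_dist_eq fun _ _ => rfl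
  { r, s, a with
    toCompleteSpace := (hiso.isUniformInducing.completeSpace_congr e.surjective).2 inferInstance
    norm_mul_self_le := fun x => by
      change ‖e x‖ * ‖e x‖ ≤ ‖e (e.symm (e (e.symm (star (e x))) * e x))‖
      simp only [Equiv.apply_symm_apply]
      exact CStarRing.norm_mul_self_le (e x)
    norm_smul_le := fun c x => by
      change ‖e (e.symm (c • e x))‖ ≤ ‖c‖ * ‖e x‖
      rw [Equiv.apply_symm_apply]
      exact norm_smul_le c (e x)
    star_smul := fun c x => by
      change e.symm (star (e (e.symm (c • e x)))) = e.symm (star c • e (e.symm (star (e x))))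
      simp only [Equiv.apply_symm_apply, star_smul] }

/-- The bijection underlying a transported C⋆-algebra structure, as a ⋆-isomorphism. -/
noncomputable def Equiv.cstarAlgebraStarAlgEquiv {α β : Type*} (e : α ≃ β) [CStarAlgebra β] :
    letI := e.cstarAlgebra
    α ≃⋆ₐ[ℂ] β :=
  letI := e.cstarAlgebra
  { e with
    map_mul' := fun _ _ => e.apply_symm_apply _
    map_add' := fun _ _ => e.apply_symm_apply _
    map_star' := fun _ => e.apply_symm_apply _
    map_smul' := fun _ _ => e.apply_symm_apply _ }

end Equiv

/-! ### Separable subalgebras that stay in the class -/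

theorem Set.Countable.exists_superset_closed {α ι : Type*} [Countable ι] (f : ι → α → α → α)
    {D : Set α} (hD : D.Countable) :
    ∃ C : Set α, D ⊆ C ∧ C.Countable ∧ ∀ i, ∀ x ∈ C, ∀ y ∈ C, f i x y ∈ C := by
  let step : Set α → Set α := fun S => S ∪ ⋃ i, Set.image2 (f i) S S
  have hmono : Monotone fun n : ℕ => step^[n] D := monotone_nat_of_le_succ fun n => by
    rw [Function.iterate_succ_apply']
    exact Set.subset_union_left
  refine ⟨⋃ n : ℕ, step^[n] D, Set.subset_iUnion_of_subset 0 subset_rfl,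
    Set.countable_iUnion fun n => ?_, fun i x hx y hy => ?_⟩
  · induction n with
    | zero => exact hD
    | succ n ih =>
      rw [Function.iterate_succ_apply']
      exact ih.union (Set.countable_iUnion fun i => ih.image2 ih (f i))
  · obtain ⟨k, hk⟩ := Set.mem_iUnion.1 hx
    obtain ⟨l, hl⟩ := Set.mem_iUnion.1 hy
    refine Set.mem_iUnion.2 ⟨max k l + 1, ?_⟩
    rw [Function.iterate_succ_apply']
    exact Or.inr (Set.mem_iUnion.2 ⟨i, Set.mem_image2_of_mem (hmono (le_max_left k l) hk)
      (hmono (le_max_right k l) hl)⟩)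

section Reflection

variable {X : Type*} [CStarAlgebra X]

/-- Given countably many operations on a C⋆-algebra, every countable subset lies in a closed
⋆-subalgebra that has a countable dense subset closed under these operations. -/
theorem StarSubalgebra.exists_dense_countable_closed {ι : Type*} [Countable ι]
    (f : ι → X → X → X) {D : Set X} (hD : D.Countable) :
    ∃ (S : StarSubalgebra ℂ X) (C : Set X), D ⊆ C ∧ C.Countable ∧ closure C = S ∧
      ∀ i, ∀ x ∈ C, ∀ y ∈ C, f i x y ∈ C := by
  let alg : Fin 3 ⊕ ℕ → X → X → X :=
    Sum.elim ![fun x y => x + y, fun x y => x * y, fun x _ => star x]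
      fun k x _ => denseSeq ℂ k • x
  obtain ⟨C, hDC, hC, hcl⟩ :=
    (hD.insert 1).exists_superset_closed (Sum.elim f alg)
  have hone : (1 : X) ∈ C := hDC (Set.mem_insert _ _)
  have hadd : ∀ x ∈ C, ∀ y ∈ C, x + y ∈ C := hcl (.inr (.inl 0))
  have hmul : ∀ x ∈ C, ∀ y ∈ C, x * y ∈ C := hcl (.inr (.inl 1))
  have hstar : ∀ x ∈ C, star x ∈ C := fun x hx => hcl (.inr (.inl 2)) x hx x hx
  have hsmul : ∀ k, ∀ x ∈ C, denseSeq ℂ k • x ∈ C := fun k x hx => hcl (.inr (.inr k)) x hx x hx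
  have hsmul' : ∀ c : ℂ, ∀ x ∈ closure C, c • x ∈ closure C := fun c x hx =>
    map_mem_closure₂ continuous_smul (denseRange_denseSeq ℂ c) hx
      (by rintro _ ⟨k, rfl⟩ y hy; exact hsmul k y hy)
  refine ⟨{ carrier := closure C
            mul_mem' := fun hx hy => map_mem_closure₂ continuous_mul hx hy hmul
            add_mem' := fun hx hy => map_mem_closure₂ continuous_add hx hy hadd
            algebraMap_mem' := fun c => ?_
            star_mem' := fun hx => map_mem_closure continuous_star hx hstar }, C,
    (Set.subset_insert _ _).trans hDC, hC, rfl, fun i => hcl (.inl i)⟩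
  rw [Algebra.algebraMap_eq_smul_one]
  exact hsmul' c 1 (subset_closure hone)

/-- Radial retraction onto the closed unit ball. -/
noncomputable def radialRetraction (x : X) : X := (max 1 ‖x‖)⁻¹ • x

theorem norm_radialRetraction_le (x : X) : ‖radialRetraction x‖ ≤ 1 := by
  have hm : 0 < max 1 ‖x‖ := by positivity
  rw [radialRetraction, norm_smul, norm_inv, Real.norm_of_nonneg hm.le, inv_mul_le_one₀ hm]
  exact le_max_right _ _

theorem norm_sub_radialRetraction_le {a : X} (ha : ‖a‖ ≤ 1) (x : X) :
    ‖x - radialRetraction x‖ ≤ ‖a - x‖ := by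
  set m := max 1 ‖x‖ with hm
  have hm1 : 1 ≤ m := le_max_left _ _
  have hm0 : 0 < m := by positivity
  have hi : m⁻¹ ≤ 1 := inv_le_one_of_one_le₀ hm1
  have h : x - radialRetraction x = (1 - m⁻¹) • x := by
    rw [sub_smul, one_smul, radialRetraction]
  rw [h, norm_smul, Real.norm_of_nonneg (by linarith)]
  calc (1 - m⁻¹) * ‖x‖ ≤ (1 - m⁻¹) * m :=
        mul_le_mul_of_nonneg_left (le_max_right _ _) (by linarith)
    _ = m - 1 := by field_simp
    _ ≤ ‖a - x‖ := by
        have := norm_le_norm_add_norm_sub a x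
        rw [sub_le_iff_le_add, hm]
        exact max_le (by linarith [norm_nonneg (a - x)]) (by linarith)

/-- Approximate `n`-th roots of the elements with an open scale-invariant property `P` are given by
countably many operations. -/
theorem exists_operations_approxRoots {n : ℕ} {P : X → Prop} (hP : IsOpen {x | P x})
    (hPr : ∀ x, P x → P (radialRetraction x))
    (h : ∀ a, P a → ‖a‖ ≤ 1 → ∀ ε : ℝ, 0 < ε → ∃ b : X, ‖b‖ ≤ 1 ∧ ‖a - b ^ n‖ < ε) :
    ∃ f : ℕ → X → X → X, ∀ C : Set X, (∀ k, ∀ x ∈ C, ∀ y ∈ C, f k x y ∈ C) →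
      ∀ a ∈ closure C, P a → ‖a‖ ≤ 1 → ∀ ε : ℝ, 0 < ε →
        ∃ b ∈ C, ‖b‖ ≤ 1 ∧ ‖a - b ^ n‖ < ε := by
  choose! r hr hrn using h
  refine ⟨fun k x _ => r (radialRetraction x) (1 / (k + 1)), fun C hC a ha hPa han ε hε => ?_⟩
  obtain ⟨k, hk⟩ := exists_nat_one_div_lt (show 0 < ε / 3 by positivity)
  have hk0 : (0 : ℝ) < 1 / (k + 1) := by positivity
  obtain ⟨x, ⟨hPx, hxa⟩, hxC⟩ := mem_closure_iff_nhds.1 ha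
    ({x | P x} ∩ Metric.ball a (ε / 3))
    (inter_mem (hP.mem_nhds hPa) (Metric.ball_mem_nhds a (by positivity)))
  rw [Metric.mem_ball, dist_comm, dist_eq_norm] at hxa
  have hPr' := hPr x hPx
  have hx1 := norm_radialRetraction_le x
  refine ⟨_, hC k x hxC x hxC, hr _ hPr' hx1 _ hk0, ?_⟩
  have h1 := norm_sub_radialRetraction_le han x
  have h2 := hrn _ hPr' hx1 _ hk0
  set b := r (radialRetraction x) (1 / (k + 1))
  have h3 : a - b ^ n = (a - x) + (x - radialRetraction x) + (radialRetraction x - b ^ n) := by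
    abel
  have h4 := norm_add₃_le (a := a - x) (b := x - radialRetraction x)
    (c := radialRetraction x - b ^ n)
  rw [h3]
  linarith

theorem HasApproxRoots.exists_operations {n : ℕ} (h : HasApproxRoots n X) :
    ∃ f : ℕ → X → X → X, ∀ (S : StarSubalgebra ℂ X) [IsClosed (S : Set X)] (C : Set X),
      closure C = S → (∀ k, ∀ x ∈ C, ∀ y ∈ C, f k x y ∈ C) → HasApproxRoots n S := by
  obtain ⟨f, hf⟩ := exists_operations_approxRoots (X := X) (n := n) (P := fun _ => True)
    isOpen_univ (fun _ _ => trivial) (fun a _ => h a)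
  refine ⟨f, fun S _ C hS hC a ha ε hε => ?_⟩
  obtain ⟨b, hb, hbn, hab⟩ := hf C hC a (hS ▸ a.2) trivial ha ε hε
  have hCS : C ⊆ S := hS ▸ subset_closure
  exact ⟨⟨b, hCS hb⟩, hbn, hab⟩

theorem HasApproxRootsOfUnits.exists_operations {n : ℕ} (h : HasApproxRootsOfUnits n X) :
    ∃ f : ℕ → X → X → X, ∀ (S : StarSubalgebra ℂ X) [IsClosed (S : Set X)] (C : Set X),
      closure C = S → (∀ k, ∀ x ∈ C, ∀ y ∈ C, f k x y ∈ C) → HasApproxRootsOfUnits n S := by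
  obtain ⟨f, hf⟩ := exists_operations_approxRoots (X := X) (n := n) (P := IsUnit)
    Units.isOpen
    (fun x hx => by
      have hm : (max 1 ‖x‖)⁻¹ ≠ 0 := by positivity
      exact hx.smul (Units.mk0 _ hm)) h
  refine ⟨f, fun S _ C hS hC a hu ha ε hε => ?_⟩
  obtain ⟨b, hb, hbn, hab⟩ := hf C hC a (hS ▸ a.2) (hu.map S.subtype) ha ε hε
  have hCS : C ⊆ S := hS ▸ subset_closure
  exact ⟨⟨b, hCS hb⟩, hbn, hab⟩

/-- Inverses of elements of a closed ⋆-subalgebra stay in it, so that a tuple is unessential in the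
subalgebra as soon as the perturbations that witness it can be taken there. -/
theorem isUnessential_of_exists_mem (S : StarSubalgebra ℂ X) [IsClosed (S : Set X)] {m : ℕ}
    {y : Fin m → S}
    (h : ∀ ε : ℚ, 0 < ε → ∃ z : Fin m → X, (∀ k, z k ∈ S) ∧
      (∀ k, IsSelfAdjoint (z k)) ∧ (∀ k, ‖(y k : X) - z k‖ ≤ (ε : ℝ)) ∧
      ∃ u : Xˣ, (u : X) = ∑ k, z k ^ 2 ∧ ‖((u⁻¹ : Xˣ) : X)‖ ≤ 1 / (ε : ℝ) ^ 2) :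
    IsUnessential y := by
  intro ε hε
  obtain ⟨z, hzS, hz, hyz, u, hu, hun⟩ := h ε hε
  have hcoe : ((∑ k, (⟨z k, hzS k⟩ : S) ^ 2 : S) : X) = u := by
    rw [hu]
    simp
  have hunit : IsUnit (∑ k, (⟨z k, hzS k⟩ : S) ^ 2) := by
    rw [← StarSubalgebra.coe_isUnit, hcoe]
    exact u.isUnit
  obtain ⟨v, hv⟩ := hunit
  have huv : u = Units.map (S.subtype : S →* X) v := by
    ext
    rw [← hcoe, ← hv]
    rfl
  refine ⟨fun k => ⟨z k, hzS k⟩, fun k => Subtype.ext (hz k), hyz, v, hv, ?_⟩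
  rw [huv] at hun
  exact hun

theorem BoundedRankLE.exists_operations (h : BoundedRankLE X 1) :
    ∃ f : (ℕ × Fin 2) ⊕ (ℚ × Fin 2) → X → X → X,
      ∀ (S : StarSubalgebra ℂ X) [IsClosed (S : Set X)] (C : Set X),
      closure C = S → (∀ k, ∀ x ∈ C, ∀ y ∈ C, f k x y ∈ C) → BoundedRankLE S 1 := by
  have h' : ∀ y : Fin (1 + 1) → X, IsUnessential y → ∀ ε : ℚ, 0 < ε → ∃ z : Fin (1 + 1) → X,
    (∀ k, IsSelfAdjoint (z k)) ∧ (∀ k, ‖y k - z k‖ ≤ (ε : ℝ)) ∧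
      ∃ u : Xˣ, (u : X) = ∑ k, z k ^ 2 ∧ ‖((u⁻¹ : Xˣ) : X)‖ ≤ 1 / (ε : ℝ) ^ 2 := fun _ h => h
  choose! Y hYsa hYun hxY using h
  choose! Z hZ using h'
  let f : (ℕ × Fin 2) ⊕ (ℚ × Fin 2) → X → X → X :=
    Sum.elim (fun i x y => Y ![realPart x, realPart y] (1 / (i.1 + 1)) i.2)
      fun i x y => Z ![x, y] i.1 i.2
  refine ⟨f, fun S hSc C hS hC x hx ε hε => ?_⟩
  have hCS : C ⊆ S := hS ▸ subset_closure
  have hvec : ∀ v : Fin (1 + 1) → X, v = ![v 0, v 1] := fun v => by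
    ext k
    fin_cases k <;> rfl
  have happrox : ∀ k, ∃ c ∈ C, ‖(x k : X) - c‖ < ε / 2 := fun k => by
    have hk : (x k : X) ∈ closure C := hS ▸ (x k).2
    simpa only [dist_eq_norm] using Metric.mem_closure_iff.1 hk (ε / 2) (half_pos hε)
  choose c hcC hxc using happrox
  obtain ⟨N, hN⟩ := exists_nat_one_div_lt (half_pos hε)
  have hN0 : (0 : ℝ) < 1 / (N + 1) := by positivity
  let s : Fin (1 + 1) → X := fun k => realPart (c k)
  have hs : ∀ k, IsSelfAdjoint (s k) := fun k => (realPart (c k)).2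
  -- Passing to the real part does not move away from the self-adjoint element `x k`.
  have hxs : ∀ k, ‖(x k : X) - s k‖ < ε / 2 := fun k => by
    have hxk : IsSelfAdjoint (x k : X) := (hx k).map S.subtype
    have h1 : (x k : X) - s k = realPart ((x k : X) - c k) := by
      rw [map_sub, AddSubgroupClass.coe_sub, hxk.coe_realPart]
    rw [h1]
    exact (realPart.norm_le _).trans_lt (hxc k)
  have hYC : ∀ k, Y s (1 / (N + 1)) k ∈ C := fun k => by
    have := hC (.inl (N, k)) (c 0) (hcC 0) (c 1) (hcC 1)
    rw [hvec s]
    exact this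
  refine ⟨fun k => ⟨Y s (1 / (N + 1)) k, hCS (hYC k)⟩,
    fun k => Subtype.ext (hYsa s hs _ hN0 k), isUnessential_of_exists_mem S fun δ hδ => ?_,
    fun k => ?_⟩
  · refine ⟨Z (Y s (1 / (N + 1))) δ, fun k => hCS ?_, hZ _ (hYun s hs _ hN0) δ hδ⟩
    have := hC (.inr (δ, k)) _ (hYC 0) _ (hYC 1)
    rw [hvec (Y s (1 / (N + 1)))]
    exact this
  · have h1 := hxY s hs _ hN0 k
    have h2 := norm_sub_le_norm_sub_add_norm_sub (x k : X) (s k) (Y s (1 / (N + 1)) k)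
    have h3 := hxs k
    change ‖(x k : X) - Y s (1 / (N + 1)) k‖ < ε
    linarith

theorem RootClass.Mem.exists_operations {K : RootClass} {n : ℕ} (h : K.Mem n X) :
    ∃ (ι : Type) (_ : Countable ι) (f : ι → X → X → X),
      ∀ (S : StarSubalgebra ℂ X) [IsClosed (S : Set X)] (C : Set X),
      closure C = S → (∀ k, ∀ x ∈ C, ∀ y ∈ C, f k x y ∈ C) → K.Mem n S := by
  match K, h with
  | .AP, h =>
    obtain ⟨f, hf⟩ := HasApproxRoots.exists_operations h
    exact ⟨_, inferInstance, f, hf⟩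
  | .AP₁, h =>
    obtain ⟨f, hf⟩ := h.1.exists_operations
    obtain ⟨g, hg⟩ := h.2.exists_operations
    exact ⟨_, inferInstance, Sum.elim f g, fun S _ C hS hC =>
      ⟨hf S C hS fun k => hC (.inl k), hg S C hS fun k => hC (.inr k)⟩⟩
  | .HP, h =>
    obtain ⟨f, hf⟩ := HasApproxRootsOfUnits.exists_operations h
    exact ⟨_, inferInstance, f, hf⟩

/-- A Löwenheim–Skolem property of the classes: every countable subset of a member lies in a
separable C⋆-subalgebra that is again a member. -/
theorem RootClass.Mem.exists_separable_starSubalgebra {K : RootClass} {n : ℕ} (h : K.Mem n X)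
    {D : Set X} (hD : D.Countable) :
    ∃ (S : StarSubalgebra ℂ X) (_ : IsClosed (S : Set X)),
      D ⊆ S ∧ SeparableSpace S ∧ K.Mem n S := by
  obtain ⟨ι, _, f, hf⟩ := h.exists_operations
  obtain ⟨S, C, hDC, hC, hS, hcl⟩ := StarSubalgebra.exists_dense_countable_closed f hD
  have hSc : IsClosed (S : Set X) := hS ▸ isClosed_closure
  refine ⟨S, hSc, hDC.trans (hS ▸ subset_closure), ?_, hf S C hS hcl⟩
  have : IsSeparable (S : Set X) := hS ▸ hC.isSeparable.closure
  exact this.separableSpace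

end Reflection

/-! ### The universal algebra -/

/-- A subset of `ℕ → ℝ` as a bare type, without the topology of the product. Up to isomorphism,
all separable C⋆-algebras live on such types. -/
def BareSubset (s : Set (ℕ → ℝ)) : Type := s

/-- The ⋆-homomorphisms of `A` into nontrivial members of the class that live on subsets of
`ℕ → ℝ`. This is a type in the lowest universe. -/
structure RootClass.SmallHom (K : RootClass) (n : ℕ) (A : Type) [CStarAlgebra A] : Type where
  carrier : Set (ℕ → ℝ)
  cstarAlgebra : CStarAlgebra (BareSubset carrier)
  nontrivial : Nontrivial (BareSubset carrier)
  mem : K.Mem n (BareSubset carrier)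
  hom : A →⋆ₐ[ℂ] BareSubset carrier

theorem exists_equiv_bareSubset (Y : Type*) [MetricSpace Y] [SeparableSpace Y] [Nonempty Y] :
    ∃ s : Set (ℕ → ℝ), Nonempty (BareSubset s ≃ Y) := by
  let d : Y → ℕ → ℝ := fun y k => dist y (denseSeq Y k)
  have hd : Function.Injective d := by
    intro x y hxy
    have h : (fun z => dist x z) = fun z => dist y z :=
      (denseRange_denseSeq Y).equalizer (by fun_prop) (by fun_prop) hxy
    have := congr_fun h y
    simpa using this
  exact ⟨Set.range d, ⟨(Equiv.ofInjective d hd).symm⟩⟩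

/-- The invertible ⋆-homomorphism maps diagonally into the bounded product of all small
⋆-homomorphisms, with codomain a separable member of the class inside this product. -/
theorem RootClass.exists_isInvertibleHom (K : RootClass) (n : ℕ) (G : Type) [Group G]
    [Countable G] :
    ∃ (Z : Type) (_ : CStarAlgebra Z), SeparableSpace Z ∧ K.Mem n Z ∧
      ∃ p : GroupCStarAlgebra G →⋆ₐ[ℂ] Z, RootClass.IsInvertibleHom.{0, 0, w} K n p := by
  let F : K.SmallHom n (GroupCStarAlgebra G) → Type := fun t => BareSubset t.carrier
  let _ : ∀ t, CStarAlgebra (F t) := fun t => t.cstarAlgebra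
  have : ∀ t, Nontrivial (F t) := fun t => t.nontrivial
  let Φ : GroupCStarAlgebra G →⋆ₐ[ℂ] lp F ∞ := lp.liftStarAlgHom fun t => t.hom
  have hmem : K.Mem n (lp F ∞) := RootClass.Mem.lp_infty fun t => t.mem
  let gen : G → GroupCStarAlgebra G := fun g => GroupCStarAlgebra.coe (StarGroupRing.of g)
  obtain ⟨S, hSc, hDS, hsep, hS⟩ := hmem.exists_separable_starSubalgebra
    (Set.countable_range (Φ ∘ gen))
  have hΦ : ∀ a, Φ a ∈ S := GroupCStarAlgebra.map_mem_of_forall_of_mem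
    (S := Subalgebra.toSubmodule S.toSubalgebra) hSc Φ fun g => hDS ⟨g, rfl⟩
  refine ⟨S, inferInstance, hsep, hS, Φ.codRestrict S hΦ, fun X _ hX g => ?_⟩
  -- Mathlib's ring structure on `lp F ∞` needs nontrivial factors, so `X = 0` is not among them.
  rcases subsingleton_or_nontrivial X with hX0 | hX1
  · refine ⟨{ toFun := fun _ => 0, map_one' := Subsingleton.elim _ _,
              map_mul' := fun _ _ => Subsingleton.elim _ _, map_zero' := rfl,
              map_add' := fun _ _ => Subsingleton.elim _ _,
              commutes' := fun _ => Subsingleton.elim _ _,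
              map_star' := fun _ => Subsingleton.elim _ _ }, ?_⟩
    ext a
    exact Subsingleton.elim _ _
  obtain ⟨Y, hYc, hDY, hYsep, hY⟩ := hX.exists_separable_starSubalgebra
    (Set.countable_range (g ∘ gen))
  have hg : ∀ a, g a ∈ Y := GroupCStarAlgebra.map_mem_of_forall_of_mem
    (S := Subalgebra.toSubmodule Y.toSubalgebra) hYc g fun x => hDY ⟨x, rfl⟩
  obtain ⟨s, ⟨e⟩⟩ := exists_equiv_bareSubset Y
  let _ : CStarAlgebra (BareSubset s) := e.cstarAlgebra
  let E : BareSubset s ≃⋆ₐ[ℂ] Y := e.cstarAlgebraStarAlgEquiv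
  let t : K.SmallHom n (GroupCStarAlgebra G) :=
    { carrier := s
      cstarAlgebra := inferInstance
      nontrivial := e.nontrivial
      mem := hY.of_starAlgEquiv E.symm
      hom := (E.symm : Y →⋆ₐ[ℂ] BareSubset s).comp (g.codRestrict Y hg) }
  refine ⟨((Y.subtype.comp (E : BareSubset s →⋆ₐ[ℂ] Y)).comp (lp.evalStarAlgHom t)).comp
    S.subtype, ?_⟩
  ext a
  change g a = (E (E.symm ⟨g a, hg a⟩) : X)
  rw [StarAlgEquiv.apply_symm_apply]

theorem theorem1p4 (n : ℕ) (hn : 0 < n) (K : RootClass) :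
    ∃ (Z : Type) (_ : CStarAlgebra Z),
      TopologicalSpace.SeparableSpace Z ∧ K.Mem n Z ∧
      (∃ p : GroupCStarAlgebra (FreeGroup ℕ) →⋆ₐ[ℂ] Z,
        RootClass.IsInvertibleHom.{0, 0, w} K n p) ∧
      RootClass.IsUniversalSeparable.{0, w} K n Z := by
  obtain ⟨Z, _, hsep, hmem, p, hp⟩ := RootClass.exists_isInvertibleHom.{w} K n (FreeGroup ℕ)
  refine ⟨Z, inferInstance, hsep, hmem, ⟨p, hp⟩, hsep, hmem, fun X _ hX hXK => ?_⟩
  obtain ⟨g, hg⟩ := exists_surjective_groupCStarAlgebra_freeGroup X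
  obtain ⟨h, rfl⟩ := hp X hXK g
  exact ⟨h, Function.Surjective.of_comp hg⟩
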